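/- Let $R$ be a real closed extension field of $\mathbb R$, let $\mathcal O=\{a\in R\mid \exists N\in\mathbb N: -N\le a\le N\}$ be its ring of finite elements, and let $\operatorname{st}\colon\mathcal O\to\mathbb R$ be the standard part map ($\operatorname{st}(a)$ is the unique real number such that $|a-\operatorname{st}(a)|\le\frac1N$ for all $N\in\mathbb N=\{1,2,\dots\}$), applied to points of $\mathcal O^n$ coordinatewise. Let $n\in\mathbb N_0$ and write $\mathcal O[X]=\mathcal O[X_1,\dots,X_n]$. Let $M\subseteq\mathcal O[X]$ be an Archimedean quadratic module, i.e. $0,1\in M$, $M+M\subseteq M$, $a^2M\subseteq M$ for all $a\in\mathcal O[X]$, and for every $a\in\mathcal O[X]$ there is $N\in\mathbb N$ with $N\pm a\in M$. Set \[S:=\{x\in\mathbb R^n\mid \forall p\in M:\ \operatorname{st}(p(x))\ge 0\}.\] For $x=(\xi_1,\dots,\xi_n)\in\mathcal O^n$ let $I_x:=\{p\in\mathcal O[X]\mid p(x)=0\}$ and $u_x:=(X_1-\xi_1)^2+\dots+(X_n-\xi_n)^2$. Let $k\in\mathbb N_0$ and let $x_1,\dots,x_k\in\mathcal O^n$ satisfy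 $\operatorname{st}(x_i)\neq\operatorname{st}(x_j)$ for $i\ne j$. Set \[I:=I_{x_1}^2\cdots I_{x_k}^2\qquad\text{and}\qquad u:=u_{x_1}\cdots u_{x_k}\in I,\] where squares and products of ideals are taken in the sense of ideals (empty products being $\mathcal O[X]$ and $1$), and regard $I$ as a real vector space. Then: (a) $I=I_{x_1}^2\cap\dots\cap I_{x_k}^2$. (b) $u$ is a unit for the cone $M\cap I$ in $I$, i.e. for every $p\in I$ there is $N\in\mathbb N$ with $Nu+p\in M\cap I$. (c) Let $\varphi$ be a pure state of $(I,M\cap I,u)$, i.e. an extreme point of the convex set of all $\mathbb R$-linear maps $\varphi\colon I\to\mathbb R$ with $\varphi(M\cap I)\subseteq\mathbb R_{\ge0}$ and $\varphi(u)=1$. Then exactly one of the following two cases occurs: (1) There is an $x\in S\setminus\{\operatorname{st}(x_1),\dots,\operatorname{st}(x_k)\}$ such that \[\varphi(p)=\operatorname{st}\left(\frac{p(x)}{u(x)}\right)\quad\text{for all }p\in I.\] (2) There are $i\in\{1,\dots,k\}$ and $v_1,\dots,v_n\in\mathbb R^n$ such that $\sum_{\ell=1}^n v_\ell^Tv_\ell=1$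 and \[\varphi(p)=\operatorname{st}\left(\frac{\sum_{\ell=1}^n v_\ell^T(\operatorname{Hess}p)(x_i)\,v_\ell}{2\prod_{j\ne i}u_{x_j}(x_i)}\right)\quad\text{for all }p\in I,\] where $\operatorname{Hess}p$ is the matrix of formal second partial derivatives of $p$. -/

import Mathlib

open MvPolynomial

noncomputable section

/-! ### Quadratic modules -/

/-- A quadratic module of a commutative ring `A`: a subset `M` with
`0, 1 ∈ M`, `M + M ⊆ M` and `A² M ⊆ M`. -/
structure QuadModule (A : Type*) [CommRing A] where
  carrier : Set A
  zero_mem' : (0 : A) ∈ carrier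
  one_mem' : (1 : A) ∈ carrier
  add_mem' : ∀ a ∈ carrier, ∀ b ∈ carrier, a + b ∈ carrier
  sq_mul_mem' : ∀ (a : A), ∀ b ∈ carrier, a ^ 2 * b ∈ carrier

namespace QuadModule

instance {A : Type*} [CommRing A] : SetLike (QuadModule A) A where
  coe := QuadModule.carrier
  coe_injective := by
    rintro ⟨a, _, _, _, _⟩ ⟨b, _, _, _, _⟩ h
    cases h
    rfl

/-- `M` is Archimedean: for every `a` there is a positive integer `N` with `N ± a ∈ M`. -/
def IsArchimedean {A : Type*} [CommRing A] (M : QuadModule A) : Prop :=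
  ∀ a : A, ∃ N : ℕ, 0 < N ∧ (N : A) + a ∈ M ∧ (N : A) - a ∈ M

/-- The set `M ∩ I`, as a convex cone in the real vector space `I`. -/
def interIdeal {A : Type*} [CommRing A] [Algebra ℝ A] (M : QuadModule A) (I : Ideal A) :
    PointedCone ℝ I where
  carrier := {p | (p : A) ∈ M}
  zero_mem' := M.zero_mem'
  add_mem' := fun {a b} ha hb => M.add_mem' a ha b hb
  smul_mem' := by
    rintro ⟨c, hc⟩ p hp
    have h := M.sq_mul_mem' (algebraMap ℝ A (Real.sqrt c)) (p : A) hp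
    rw [← map_pow, Real.sq_sqrt hc, ← Algebra.smul_def] at h
    exact h

end QuadModule

/-! ### Units of cones, states, pure states -/

/-- `u` is a unit for the cone `C` in the real vector space `V`: for every `x ∈ V` there is a
positive integer `N` with `N u + x ∈ C`. -/
def IsConeUnit {V : Type*} [AddCommGroup V] [Module ℝ V] (C : PointedCone ℝ V) (u : V) : Prop :=
  ∀ x : V, ∃ N : ℕ, 0 < N ∧ N • u + x ∈ C

/-- The state space of `(V, C, u)`: the linear forms on `V` that are nonnegative on `C` and take
the value `1` at `u`. -/
def stateSpace {V : Type*} [AddCommGroup V] [Module ℝ V] (C : Set V) (u : V) :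
    Set (V →ₗ[ℝ] ℝ) :=
  {φ | (∀ c ∈ C, 0 ≤ φ c) ∧ φ u = 1}

/-- A pure state of `(V, C, u)`: an extreme point of the state space. -/
def IsPureState {V : Type*} [AddCommGroup V] [Module ℝ V] (C : Set V) (u : V)
    (φ : V →ₗ[ℝ] ℝ) : Prop :=
  φ ∈ Set.extremePoints ℝ (stateSpace C u)

/-! ### Finite elements of an ordered extension field of `ℝ`, standard parts -/

section Field

variable (R : Type*) [Field R] [LinearOrder R] [IsStrictOrderedRing R] [Algebra ℝ R]

/-- The ring of finite elements of `R` (those `a` with `-N ≤ a ≤ N` for some `N ∈ ℕ`),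
as an `ℝ`-subalgebra of `R`. -/
def finiteElements : Subalgebra ℝ R where
  carrier := {a | ∃ N : ℕ, -(N : R) ≤ a ∧ a ≤ N}
  mul_mem' := by
    rintro a b ⟨N, hN⟩ ⟨K, hK⟩
    refine ⟨N * K, ?_⟩
    have h := mul_le_mul (abs_le.2 hN) (abs_le.2 hK) (abs_nonneg b) (Nat.cast_nonneg N)
    rw [← abs_mul] at h
    rw [Nat.cast_mul]
    exact abs_le.1 h
  add_mem' := by
    rintro a b ⟨N, hN, hN'⟩ ⟨K, hK, hK'⟩
    refine ⟨N + K, ?_, ?_⟩ <;> push_cast <;> linarith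
  algebraMap_mem' := by
    have pos : ∀ t : ℝ, 0 ≤ t → 0 ≤ algebraMap ℝ R t := fun t ht => by
      rw [← Real.sq_sqrt ht, map_pow]
      exact sq_nonneg _
    intro r
    obtain ⟨N, hN⟩ := exists_nat_ge |r|
    obtain ⟨h1, h2⟩ := abs_le.1 hN
    refine ⟨N, ?_, ?_⟩
    · have h := pos (r + N) (by linarith)
      rw [map_add, map_natCast] at h
      linarith
    · have h := pos (N - r) (by linarith)
      rw [map_sub, map_natCast] at h
      linarith

/-- The polynomial ring `𝒪[X₁, …, Xₙ]` over the ring `𝒪` of finite elements of `R`. -/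
abbrev FinPoly (n : ℕ) : Type _ := MvPolynomial (Fin n) (finiteElements R)

variable {R} {n : ℕ}

/-- The standard part of a point with finite coordinates. -/
def stPoint (x : Fin n → finiteElements R) : Fin n → ℝ :=
  fun j => ArchimedeanClass.stdPart (x j : R)

/-- A real point, regarded as a point with finite coordinates. -/
def realPoint (R : Type*) [Field R] [LinearOrder R] [IsStrictOrderedRing R] [Algebra ℝ R]
    {n : ℕ} (x : Fin n → ℝ) : Fin n → finiteElements R :=
  fun j => algebraMap ℝ (finiteElements R) (x j)

/-- `{x ∈ ℝⁿ | st (p(x)) ≥ 0 for all p ∈ M}`. -/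
def stNonnegSet (M : QuadModule (FinPoly R n)) : Set (Fin n → ℝ) :=
  {x | ∀ p ∈ M, 0 ≤ ArchimedeanClass.stdPart (eval (realPoint R x) p : R)}

/-! ### The ideals `I_x` and the polynomials `u_x` -/

/-- `I_x`, the kernel of the evaluation `𝒪[X] → 𝒪`, `p ↦ p(x)`. -/
def pointIdeal (x : Fin n → finiteElements R) : Ideal (FinPoly R n) :=
  RingHom.ker (eval x)

/-- `u_x = (X₁ - x₁)² + ⋯ + (Xₙ - xₙ)²`. -/
def pointUnit (x : Fin n → finiteElements R) : FinPoly R n :=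
  ∑ j, (X j - C (x j)) ^ 2

theorem pointUnit_mem (x : Fin n → finiteElements R) : pointUnit x ∈ pointIdeal x ^ 2 := by
  refine Ideal.sum_mem _ fun j _ => Ideal.pow_mem_pow ?_ 2
  rw [pointIdeal, RingHom.mem_ker]
  simp

/-- `I = I_{x₁}² ⋯ I_{xₖ}²`. -/
def prodIdeal {k : ℕ} (x : Fin k → Fin n → finiteElements R) : Ideal (FinPoly R n) :=
  ∏ i, pointIdeal (x i) ^ 2

/-- `u = u_{x₁} ⋯ u_{xₖ}`, as an element of `I`. -/
def prodUnit {k : ℕ} (x : Fin k → Fin n → finiteElements R) : prodIdeal x :=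
  ⟨∏ i, pointUnit (x i), Ideal.prod_mem_prod fun i _ => pointUnit_mem (x i)⟩

/-- The Hessian (formal second partial derivatives) of `p`, evaluated at `x`. -/
def hessAt (p : FinPoly R n) (x : Fin n → finiteElements R) :
    Matrix (Fin n) (Fin n) (finiteElements R) :=
  Matrix.of fun a b => eval x (pderiv a (pderiv b p))

/-- `vᵀ (Hess p)(x) v` for a real vector `v`. -/
def hessForm (p : FinPoly R n) (x : Fin n → finiteElements R) (v : Fin n → ℝ) :
    finiteElements R :=
  realPoint R v ⬝ᵥ Matrix.mulVec (hessAt p x) (realPoint R v)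

end Field

end

/-!
The point is that a pure state `φ` of `(I, M ∩ I, u)` is multiplicative over the ring:
`φ (a p) = φ (a u) φ p` for all polynomials `a` and all `p ∈ I`
(`QuadModule.apply_smul_of_isPureState`). Indeed, for a polynomial `b` the form `p ↦ φ (b² p)` is
nonnegative on `M ∩ I`, and since `M` is Archimedean it is dominated there by a multiple of `φ`
(`QuadModule.apply_sq_mul_le`); purity makes it proportional to `φ`
(`IsPureState.eq_smul_of_le`), and squares span the ring.

Hence `a ↦ φ (a u)` is a homomorphism of real algebras `𝒪[X] → ℝ`. As nonnegative elements of `𝒪`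
are squares, it is `a ↦ st (a(y))` for a real point `y` (`algHom_finPoly_eq_stEval`), and `y ∈ S`
because `u` is a sum of squares. If `y` is none of the `st (x_i)`, then `st (u(y)) ≠ 0`, and
`st (u(y)) φ p = φ (u p) = st (p(y)) φ u` is the first case. If `y = st (x_i)`, then, after
multiplication by the factors of `u` other than `u_{x_i}`, the state `φ` is determined by the
positive semidefinite matrix of its values at the products of two of the forms `X_j - x_{i,j}`; a
factorization of this matrix gives the second case (`exists_apply_eq_hessForm_div`). The two cases
exclude each other because they assign to `X_j u` the `j`-th coordinates of different points.

The unit property holds because `u` is the sum of the squares of the products `g` of one linear form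
for each point, and `I` is contained in the square of the ideal generated by these products
(`QuadModule.exists_nsmul_add_mem_of_mem_span_sq`). The intersection formula is the Chinese remainder
theorem: a difference of coordinates with nonzero standard part is a unit of `𝒪`.
-/

/-! ### Pure states of cones -/

/-- A nonnegative log-convex sequence bounded by a geometric sequence of ratio `N` starts with a step
of ratio at most `N`. -/
theorem le_mul_of_sq_le_mul_of_le_geometric {c : ℕ → ℝ} {K N : ℝ} (hN : 0 < N)
    (hc : ∀ m, 0 ≤ c m) (hconv : ∀ m, c (m + 1) ^ 2 ≤ c m * c (m + 2))
    (hle : ∀ m, c m ≤ K * N ^ m) : c 1 ≤ N * c 0 := by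
  by_contra! hlt
  have h0 : 0 < c 0 := by
    refine (hc 0).lt_of_ne fun h => ?_
    have := hconv 0
    rw [← h] at this hlt
    nlinarith
  have hr : ∃ r, N < r ∧ r * c 0 ≤ c 1 := ⟨c 1 / c 0, by rwa [lt_div_iff₀ h0], by
    rw [div_mul_cancel₀ _ h0.ne']⟩
  obtain ⟨r, hNr, hr⟩ := hr
  have hr0 : 0 < r := hN.trans hNr
  -- log-convexity propagates the initial growth rate `r` to all later steps.
  have step : ∀ m, 0 < c m ∧ r * c m ≤ c (m + 1) := by
    intro m
    induction m with
    | zero => exact ⟨h0, hr⟩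
    | succ m ih =>
      obtain ⟨hm, hm'⟩ := ih
      have hpos : 0 < c (m + 1) := lt_of_lt_of_le (mul_pos hr0 hm) hm'
      refine ⟨hpos, ?_⟩
      have h1 : c m * (r * c (m + 1)) ≤ c m * c (m + 2) := by
        refine le_trans ?_ (hconv m)
        nlinarith
      exact le_of_mul_le_mul_left h1 hm
  have grow : ∀ m, r ^ m * c 0 ≤ c m := by
    intro m
    induction m with
    | zero => simp
    | succ m ih =>
      refine le_trans ?_ (step m).2
      rw [pow_succ']
      nlinarith
  obtain ⟨m, hm⟩ := pow_unbounded_of_one_lt (K / c 0) ((one_lt_div hN).2 hNr)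
  rw [div_pow, div_lt_div_iff₀ h0 (by positivity)] at hm
  exact absurd ((grow m).trans (hle m)) (not_le.2 hm)

/-- A pure state spans an extreme ray of the dual cone: a linear form that is nonnegative on the cone
and dominated there by a multiple of a pure state `φ` is a multiple of `φ`. -/
theorem IsPureState.eq_smul_of_le {V : Type*} [AddCommGroup V] [Module ℝ V]
    {C : PointedCone ℝ V} {u : V} (hu : u ∈ C) (hunit : IsConeUnit C u) {φ ψ : V →ₗ[ℝ] ℝ}
    (hφ : IsPureState (C : Set V) u φ) {K : ℝ} (hψ : ∀ p ∈ C, 0 ≤ ψ p)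
    (hψφ : ∀ p ∈ C, ψ p ≤ K * φ p) : ψ = ψ u • φ := by
  obtain ⟨⟨hφC, hφu⟩, hext⟩ := hφ
  rcases (hψ u hu).eq_or_lt with h0 | hpos
  · -- a form that is nonnegative on the cone and vanishes at the unit is zero
    have hneg : ∀ p, 0 ≤ ψ p := fun p => by
      obtain ⟨N, -, hN⟩ := hunit p
      have := hψ _ hN
      rwa [map_add, map_nsmul, ← h0, smul_zero, zero_add] at this
    ext p
    have h1 := hneg (-p)
    rw [map_neg] at h1
    rw [← h0, zero_smul, LinearMap.zero_apply]
    exact le_antisymm (by linarith) (hneg p)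
  · have hK : ψ u ≤ K := by simpa [hφu] using hψφ u hu
    -- `φ` is a convex combination of the states proportional to `ψ` and to `2Kφ - ψ`
    have hK2 : 0 < 2 * K - ψ u := by linarith
    have h1 : (ψ u)⁻¹ • ψ ∈ stateSpace (C : Set V) u := by
      refine ⟨fun p hp => ?_, ?_⟩
      · exact mul_nonneg (inv_nonneg.2 hpos.le) (hψ p hp)
      · simp [hpos.ne']
    have h2 : (2 * K - ψ u)⁻¹ • ((2 * K) • φ - ψ) ∈ stateSpace (C : Set V) u := by
      refine ⟨fun p hp => ?_, ?_⟩
      · refine mul_nonneg (inv_nonneg.2 hK2.le) ?_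
        have a := hψφ p hp
        have b := hψ p hp
        simp only [LinearMap.sub_apply, LinearMap.smul_apply, smul_eq_mul]
        linarith
      · simp [hφu, hK2.ne']
    have hKpos : 0 < 2 * K := by linarith
    have hseg := hext h1 h2 ⟨ψ u / (2 * K), (2 * K - ψ u) / (2 * K), div_pos hpos hKpos,
      div_pos hK2 hKpos, by rw [← add_div, add_sub_cancel, div_self hKpos.ne'], by
        rw [smul_smul, smul_smul]
        have e1 : ψ u / (2 * K) * (ψ u)⁻¹ = (2 * K)⁻¹ := by field_simp
        have e2 : (2 * K - ψ u) / (2 * K) * (2 * K - ψ u)⁻¹ = (2 * K)⁻¹ := by field_simp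
        rw [e1, e2, ← smul_add, add_sub_cancel, smul_smul, inv_mul_cancel₀ hKpos.ne', one_smul]⟩
    rw [← hseg, smul_smul, mul_inv_cancel₀ hpos.ne', one_smul]

/-! ### Quadratic modules and states on ideals -/

namespace QuadModule

variable {A : Type*} [CommRing A]

theorem add_mem (M : QuadModule A) {a b : A} (ha : a ∈ M) (hb : b ∈ M) : a + b ∈ M :=
  M.add_mem' a ha b hb

theorem sq_mul_mem (M : QuadModule A) (a : A) {b : A} (hb : b ∈ M) : a ^ 2 * b ∈ M :=
  M.sq_mul_mem' a b hb

theorem sq_mem (M : QuadModule A) (a : A) : a ^ 2 ∈ M := by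
  simpa using M.sq_mul_mem a M.one_mem'

theorem sum_mem (M : QuadModule A) {ι : Type*} {s : Finset ι} {f : ι → A}
    (h : ∀ i ∈ s, f i ∈ M) : ∑ i ∈ s, f i ∈ M := by
  classical
  induction s using Finset.induction_on with
  | empty => exact M.zero_mem'
  | insert a s ha ih =>
    rw [Finset.sum_insert ha]
    exact M.add_mem (h _ (by simp)) (ih fun i hi => h i (by simp [hi]))

theorem smul_mem [Algebra ℝ A] (M : QuadModule A) {r : ℝ} (hr : 0 ≤ r) {a : A} (ha : a ∈ M) :
    r • a ∈ M := by
  have h := M.sq_mul_mem (algebraMap ℝ A (Real.sqrt r)) ha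
  rwa [← map_pow, Real.sq_sqrt hr, ← Algebra.smul_def] at h

variable [Algebra ℝ A] {M : QuadModule A} {I : Ideal A} {u : I}

/-- If `N - b²` lies in `M`, multiplication by `b²` increases `φ` by a factor at most `N` on `M ∩ I`.
For `q ∈ M ∩ I` the moments `φ (b²ᵐ q)` form a log-convex sequence by the Cauchy–Schwarz inequality;
they are bounded by a multiple of `φ (b²ᵐ u) ≤ Nᵐ φ u`, as `M u ⊆ M`. The product `(N - b²) q`
itself need not lie in `M`. -/
theorem apply_sq_mul_le (hunit : IsConeUnit (M.interIdeal I) u)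
    (hu : ∀ m ∈ M, m * (u : A) ∈ M) {φ : I →ₗ[ℝ] ℝ} (hφ : ∀ p ∈ M.interIdeal I, 0 ≤ φ p)
    {b : A} {N : ℝ} (hN : 0 < N) (hb : algebraMap ℝ A N - b ^ 2 ∈ M) {q : I}
    (hq : (q : A) ∈ M) : φ (b ^ 2 • q) ≤ N * φ q := by
  have key : ∀ e : A, 0 ≤ φ (e ^ 2 • q) := fun e => hφ _ (M.sq_mul_mem e hq)
  obtain ⟨L, -, hL⟩ := hunit (-q)
  have := le_mul_of_sq_le_mul_of_le_geometric (c := fun m => φ ((b ^ m) ^ 2 • q))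
    (N := N) (K := L * φ u) hN (fun m => key _) ?_ ?_
  · simpa using this
  · -- the Cauchy–Schwarz inequality for `(e, f) ↦ φ (e f q)`
    intro m
    have h := discrim_le_zero (a := φ ((b ^ m) ^ 2 • q)) (b := 2 * φ ((b ^ (m + 1)) ^ 2 • q))
      (c := φ ((b ^ (m + 2)) ^ 2 • q)) fun x => by
        have h := key (x • b ^ m + b ^ (m + 2))
        have e : (x • b ^ m + b ^ (m + 2)) ^ 2 • q = (x * x) • ((b ^ m) ^ 2 • q)
            + (2 * x) • ((b ^ (m + 1)) ^ 2 • q) + (b ^ (m + 2)) ^ 2 • q := by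
          ext
          simp only [Algebra.smul_def, Submodule.coe_add, Submodule.coe_smul,
            Submodule.coe_smul_of_tower, map_mul, map_ofNat, Algebra.algebraMap_self,
            RingHom.id_apply]
          ring
        rw [e, map_add, map_add, φ.map_smul, φ.map_smul, smul_eq_mul, smul_eq_mul] at h
        linarith
    rw [discrim] at h
    linarith
  · intro m
    have h1 : φ ((b ^ m) ^ 2 • q) ≤ L * φ ((b ^ m) ^ 2 • u) := by
      have h := hφ ((b ^ m) ^ 2 • (L • u + -q)) (M.sq_mul_mem _ hL)
      rw [smul_add, smul_neg, map_add, map_neg, smul_comm, map_nsmul, nsmul_eq_mul] at h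
      linarith
    have h2 : φ ((b ^ m) ^ 2 • u) ≤ N ^ m * φ u := by
      clear h1
      induction m with
      | zero => simp
      | succ m ih =>
        have h := hφ ((b ^ m) ^ 2 • ((algebraMap ℝ A N - b ^ 2) • u))
          (M.sq_mul_mem _ (hu _ hb))
        have e : (b ^ m) ^ 2 • ((algebraMap ℝ A N - b ^ 2) • u)
            = N • ((b ^ m) ^ 2 • u) - (b ^ (m + 1)) ^ 2 • u := by
          ext
          simp only [Algebra.smul_def, Submodule.coe_sub, Submodule.coe_smul,
            Submodule.coe_smul_of_tower, Algebra.algebraMap_self, RingHom.id_apply]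
          ring
        rw [e, map_sub, φ.map_smul, smul_eq_mul] at h
        have := mul_le_mul_of_nonneg_left ih hN.le
        rw [pow_succ' N, mul_assoc]
        linarith
    calc φ ((b ^ m) ^ 2 • q) ≤ L * φ ((b ^ m) ^ 2 • u) := h1
      _ ≤ L * (N ^ m * φ u) := by gcongr
      _ = L * φ u * N ^ m := by ring

/-- The linear form `p ↦ φ (a p)` on the ideal `I`. -/
noncomputable def mulForm (φ : I →ₗ[ℝ] ℝ) (a : A) : I →ₗ[ℝ] ℝ :=
  φ ∘ₗ (LinearMap.lsmul A I a).restrictScalars ℝ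

/-- A pure state on an ideal is multiplicative over the ring. For a square `a = b²` the form
`p ↦ φ (b² p)` is dominated by a multiple of `φ`, hence proportional to `φ`; in general `a` is a
combination of the squares of `a + 1` and `a - 1`. -/
theorem apply_smul_of_isPureState (hM : M.IsArchimedean)
    (hunit : IsConeUnit (M.interIdeal I) u)
    (hu : ∀ m ∈ M, m * (u : A) ∈ M) {φ : I →ₗ[ℝ] ℝ}
    (hφ : IsPureState (M.interIdeal I : Set I) u φ) (a : A) (p : I) :
    φ (a • p) = φ (a • u) * φ p := by
  have huM : (u : A) ∈ M := by simpa using hu 1 M.one_mem'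
  have sq : ∀ b : A, φ (b ^ 2 • p) = φ (b ^ 2 • u) * φ p := by
    intro b
    obtain ⟨N, hN, -, hNb⟩ := hM (b ^ 2)
    have h := hφ.eq_smul_of_le (C := M.interIdeal I) (ψ := mulForm φ (b ^ 2)) (K := N) huM hunit
      (fun q hq => hφ.1.1 _ (M.sq_mul_mem b hq))
      (fun q hq => apply_sq_mul_le hunit hu hφ.1.1 (by positivity) (by simpa using hNb) hq)
    exact congrArg (· p) h
  have e : ∀ q : I, a • q = (4⁻¹ : ℝ) • ((a + 1) ^ 2 • q - (a - 1) ^ 2 • q) := by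
    intro q
    have : (a + 1) ^ 2 • q - (a - 1) ^ 2 • q = (4 : ℝ) • (a • q) := by
      ext
      simp only [Algebra.smul_def, Submodule.coe_sub, Submodule.coe_smul,
        Submodule.coe_smul_of_tower, map_ofNat, Algebra.algebraMap_self, RingHom.id_apply]
      ring
    rw [this, smul_smul, inv_mul_cancel₀ (by norm_num), one_smul]
  rw [e p, e u, φ.map_smul, φ.map_smul, map_sub, map_sub, sq, sq, smul_eq_mul, smul_eq_mul]
  ring

/-- The homomorphism `a ↦ φ (a u)` of real algebras attached to a linear form `φ` on the ideal `I` that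
is multiplicative over the ring and takes the value `1` at `u`. -/
noncomputable def stateHom (φ : I →ₗ[ℝ] ℝ) (u : I) (h1 : φ u = 1)
    (hmul : ∀ (a : A) (p : I), φ (a • p) = φ (a • u) * φ p) : A →ₐ[ℝ] ℝ :=
  AlgHom.ofLinearMap (φ ∘ₗ ((LinearMap.toSpanSingleton A I u).restrictScalars ℝ))
    (by simpa using h1) (fun a b => by simpa [mul_smul] using hmul a (b • u))

end QuadModule

/-! ### Units of `M ∩ I` -/

theorem Ideal.exists_eq_sum_of_mem_span_range_sq {A ι : Type*} [CommRing A] [Fintype ι]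
    {g : ι → A} {p : A} (hp : p ∈ Ideal.span (Set.range g) ^ 2) :
    ∃ a : ι → ι → A, p = ∑ i, ∑ j, a i j * (g i * g j) := by
  classical
  rw [pow_two] at hp
  induction hp using Submodule.mul_induction_on' with
  | mem_mul_mem m hm n hn =>
    obtain ⟨c, rfl⟩ := Ideal.mem_span_range_iff_exists_fun.1 hm
    obtain ⟨d, rfl⟩ := Ideal.mem_span_range_iff_exists_fun.1 hn
    refine ⟨fun i j => c i * d j, ?_⟩
    rw [Finset.sum_mul_sum]
    exact Finset.sum_congr rfl fun i _ => Finset.sum_congr rfl fun j _ => by ring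
  | add x _ y _ hx hy =>
    obtain ⟨a, rfl⟩ := hx
    obtain ⟨b, rfl⟩ := hy
    refine ⟨fun i j => a i j + b i j, ?_⟩
    simp only [add_mul, Finset.sum_add_distrib]

namespace QuadModule

/-- A multiple of `∑ gᵢ²` absorbs every element of the square of the ideal generated by the `gᵢ`. For
a term `a g h` this follows from
`(g + h)² (N + a) + (g - h)² (N - a) = 2N (g² + h²) + 4 a g h`. -/
theorem exists_nsmul_add_mem_of_mem_span_sq {A ι : Type*} [CommRing A] [Algebra ℝ A] [Fintype ι]
    {M : QuadModule A} (hM : M.IsArchimedean) (g : ι → A) {p : A}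
    (hp : p ∈ Ideal.span (Set.range g) ^ 2) :
    ∃ N : ℕ, 0 < N ∧ N • (∑ i, g i ^ 2) + p ∈ M := by
  classical
  obtain ⟨a, rfl⟩ := Ideal.exists_eq_sum_of_mem_span_range_sq hp
  set u := ∑ i, g i ^ 2 with hu
  have huM : u ∈ M := M.sum_mem fun i _ => M.sq_mem _
  have hug : ∀ i, u - g i ^ 2 ∈ M := fun i => by
    rw [hu, ← Finset.add_sum_erase _ _ (Finset.mem_univ i), add_sub_cancel_left]
    exact M.sum_mem fun j _ => M.sq_mem _
  have term : ∀ i j, ∃ N : ℕ, N • u + a i j * (g i * g j) ∈ M := by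
    intro i j
    obtain ⟨N, -, h1, h2⟩ := hM (a i j)
    refine ⟨N, ?_⟩
    have h := M.add_mem (M.smul_mem (r := 4⁻¹) (by norm_num)
      (M.add_mem (M.sq_mul_mem (g i + g j) h1) (M.sq_mul_mem (g i - g j) h2)))
      (M.smul_mem (r := N / 2) (by positivity) (M.add_mem (hug i) (hug j)))
    convert h using 1
    -- both sides agree after multiplication by the unit `4`
    have e : ∀ y z : A, (4 : ℝ) • y = (4 : ℝ) • z → y = z := fun y z hyz => by
      simpa [smul_smul] using congrArg ((4⁻¹ : ℝ) • ·) hyz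
    apply e
    rw [smul_add (4 : ℝ) _ ((N / 2 : ℝ) • _), smul_smul, smul_smul,
      show (4 : ℝ) * (N / 2) = 2 * N by ring, mul_inv_cancel₀ (by norm_num), one_smul]
    simp only [nsmul_eq_mul]
    simp only [Algebra.smul_def, map_mul, map_ofNat, map_natCast]
    ring
  choose N hN using term
  refine ⟨1 + ∑ i, ∑ j, N i j, by omega, ?_⟩
  rw [add_smul, one_smul, add_assoc, Finset.sum_smul]
  simp_rw [Finset.sum_smul]
  rw [← Finset.sum_add_distrib]
  simp_rw [← Finset.sum_add_distrib]
  exact M.add_mem huM (M.sum_mem fun i _ => M.sum_mem fun j _ => hN i j)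

end QuadModule

/-! ### Standard parts -/

section FiniteElements

variable {R : Type*} [Field R] [LinearOrder R] [IsStrictOrderedRing R] [Algebra ℝ R]

variable (R) in
/-- The embedding `ℝ → R`, as an ordered ring homomorphism; it is monotone since nonnegative reals
are squares. -/
def realOrderRingHom : ℝ →+*o R where
  toRingHom := algebraMap ℝ R
  monotone' a b h := by
    have e : algebraMap ℝ R b = algebraMap ℝ R a + algebraMap ℝ R (Real.sqrt (b - a)) ^ 2 := by
      rw [← map_pow, Real.sq_sqrt (sub_nonneg.2 h), ← map_add, add_sub_cancel]
    change algebraMap ℝ R a ≤ algebraMap ℝ R b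
    rw [e]
    exact le_add_of_nonneg_right (sq_nonneg _)

theorem mem_finiteElements_iff_mk_nonneg {a : R} :
    a ∈ finiteElements R ↔ 0 ≤ ArchimedeanClass.mk a := by
  constructor
  · rintro ⟨N, h1, h2⟩
    exact ArchimedeanClass.mk_nonneg_of_le_of_le_of_archimedean (realOrderRingHom R)
      (r := -N) (s := N) (by simpa using h1) (by simpa using h2)
  · intro h
    obtain ⟨N, hN⟩ := ArchimedeanClass.exists_nat_ge_of_mk_nonneg h
    obtain ⟨K, hK⟩ := ArchimedeanClass.exists_nat_ge_of_mk_nonneg (x := -a) (by simpa using h)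
    refine ⟨N + K, ?_, ?_⟩
    · push_cast
      linarith [Nat.cast_nonneg (α := R) N]
    · push_cast
      linarith [Nat.cast_nonneg (α := R) K]

variable (R) in
/-- The standard part map `𝒪 → ℝ`, as a homomorphism of real algebras. -/
noncomputable def stHom : finiteElements R →ₐ[ℝ] ℝ where
  toFun a := ArchimedeanClass.stdPart (a : R)
  map_one' := by simp
  map_zero' := by simp
  map_mul' a b := ArchimedeanClass.stdPart_mul (mem_finiteElements_iff_mk_nonneg.1 a.2)
    (mem_finiteElements_iff_mk_nonneg.1 b.2)
  map_add' a b := ArchimedeanClass.stdPart_add (mem_finiteElements_iff_mk_nonneg.1 a.2)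
    (mem_finiteElements_iff_mk_nonneg.1 b.2)
  commutes' r := ArchimedeanClass.stdPart_map_real (realOrderRingHom R) r

theorem stHom_apply (a : finiteElements R) : stHom R a = ArchimedeanClass.stdPart (a : R) := rfl

theorem mk_eq_zero_of_stHom_ne_zero {a : finiteElements R} (ha : stHom R a ≠ 0) :
    ArchimedeanClass.mk (a : R) = 0 := by
  by_contra h
  exact ha (ArchimedeanClass.stdPart_eq_zero.2 h)

theorem isUnit_of_stHom_ne_zero {a : finiteElements R} (ha : stHom R a ≠ 0) : IsUnit a := by
  have h := mk_eq_zero_of_stHom_ne_zero ha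
  have hinv : (a : R)⁻¹ ∈ finiteElements R := by
    rw [mem_finiteElements_iff_mk_nonneg, ArchimedeanClass.mk_inv, h, neg_zero]
  refine IsUnit.of_mul_eq_one ⟨(a : R)⁻¹, hinv⟩ (Subtype.ext ?_)
  refine mul_inv_cancel₀ fun h0 => ha ?_
  rw [stHom_apply, h0, ArchimedeanClass.stdPart_zero]

theorem stdPart_coe_div_coe (a : finiteElements R) {b : finiteElements R} (hb : stHom R b ≠ 0) :
    ArchimedeanClass.stdPart ((a : R) / (b : R)) = stHom R a / stHom R b :=
  ArchimedeanClass.stdPart_div (mem_finiteElements_iff_mk_nonneg.1 a.2)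
    (by rw [mk_eq_zero_of_stHom_ne_zero hb, neg_zero])

/-- Over a real closed field, the standard part is the only homomorphism of real algebras `𝒪 → ℝ`:
nonnegative elements are squares, so such a homomorphism is monotone. -/
theorem algHom_finiteElements_eq_stHom [IsRealClosed R] (Φ : finiteElements R →ₐ[ℝ] ℝ) :
    Φ = stHom R := by
  have nonneg : ∀ a : finiteElements R, 0 ≤ (a : R) → 0 ≤ Φ a := by
    intro a ha
    obtain ⟨r, hr⟩ := IsRealClosed.nonneg_iff_isSquare.1 ha
    have hrfin : r ∈ finiteElements R := by
      obtain ⟨N, -, hN⟩ := a.2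
      rw [hr] at hN
      -- `r² ≤ N` forces `|r| ≤ N + 1`
      refine ⟨N + 1, ?_, ?_⟩ <;> push_cast <;>
        nlinarith [Nat.cast_nonneg (α := R) N]
    have : a = ⟨r, hrfin⟩ * ⟨r, hrfin⟩ := Subtype.ext hr
    rw [this, map_mul]
    exact mul_self_nonneg _
  have mono : ∀ a b : finiteElements R, (a : R) ≤ b → Φ a ≤ Φ b := fun a b h => by
    have := nonneg (b - a) (by simpa using h)
    rw [map_sub] at this
    linarith
  ext a
  refine (ArchimedeanClass.stdPart_eq (realOrderRingHom R) (fun s hs => ?_) fun s hs => ?_).symm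
  · by_contra! hlt
    have := mono a (algebraMap ℝ _ s) hlt.le
    rw [AlgHom.commutes] at this
    exact absurd this (not_le.2 hs)
  · by_contra! hlt
    have := mono (algebraMap ℝ _ s) a hlt.le
    rw [AlgHom.commutes] at this
    exact absurd this (not_le.2 hs)

variable {n : ℕ}

/-- The ring homomorphism `p ↦ st (p(x))` from `𝒪[X]` to `ℝ`. -/
noncomputable def stEval (x : Fin n → finiteElements R) : FinPoly R n →+* ℝ :=
  (stHom R).toRingHom.comp (eval x)

theorem stEval_apply (x : Fin n → finiteElements R) (p : FinPoly R n) :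
    stEval x p = stHom R (eval x p) := rfl

@[simp] theorem stEval_X (x : Fin n → finiteElements R) (j : Fin n) :
    stEval x (X j) = stPoint x j := by
  simp [stEval_apply, stPoint, stHom_apply]

@[simp] theorem stEval_C (x : Fin n → finiteElements R) (c : finiteElements R) :
    stEval x (C c) = stHom R c := by
  simp [stEval_apply]

theorem stEval_eq_of_stPoint_eq {x y : Fin n → finiteElements R} (h : stPoint x = stPoint y) :
    stEval x = stEval y :=
  MvPolynomial.ringHom_ext (fun c => by simp) fun j => by simp [h]

@[simp] theorem stPoint_realPoint (y : Fin n → ℝ) : stPoint (realPoint R y) = y :=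
  funext fun j => (stHom R).commutes (y j)

/-- Every homomorphism of real algebras `𝒪[X] → ℝ` is `p ↦ st (p(y))` for a real point `y`. -/
theorem algHom_finPoly_eq_stEval [IsRealClosed R] (Φ : FinPoly R n →ₐ[ℝ] ℝ) (p : FinPoly R n) :
    Φ p = stEval (realPoint R fun j => Φ (X j)) p := by
  have h : (Φ : FinPoly R n →+* ℝ) = stEval (realPoint R fun j => Φ (X j)) := by
    refine MvPolynomial.ringHom_ext (fun c => ?_) fun j => by simp
    have := algHom_finiteElements_eq_stHom
      (Φ.comp (IsScalarTower.toAlgHom ℝ (finiteElements R) (FinPoly R n)))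
    simpa using DFunLike.congr_fun this c
  exact DFunLike.congr_fun h p

theorem stEval_pointUnit_ne_zero {x y : Fin n → finiteElements R} (h : stPoint x ≠ stPoint y) :
    stEval x (pointUnit y) ≠ 0 := by
  have e : stEval x (pointUnit y) = ∑ j, (stPoint x j - stPoint y j) ^ 2 := by
    simp [pointUnit, map_sum, stPoint, stHom_apply]
  rw [e, Ne, Finset.sum_eq_zero_iff_of_nonneg fun j _ => sq_nonneg _]
  contrapose! h
  exact funext fun j => by simpa [sub_eq_zero] using h j (Finset.mem_univ j)

/-! ### The ideals `I_x` -/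

theorem pointIdeal_eq_span (x : Fin n → finiteElements R) :
    pointIdeal x = Ideal.span (Set.range fun j => (X j - C (x j) : FinPoly R n)) := by
  apply le_antisymm
  · -- modulo the linear forms `X j - x j`, every polynomial is its value at `x`
    have key : ∀ p : FinPoly R n, p - C (eval x p) ∈
        Ideal.span (Set.range fun j => (X j - C (x j) : FinPoly R n)) := by
      intro p
      induction p using MvPolynomial.induction_on with
      | C a => simp
      | add p q hp hq =>
        convert Ideal.add_mem _ hp hq using 1
        rw [map_add, map_add]
        ring
      | mul_X p j hp =>
        convert Ideal.add_mem _ (Ideal.mul_mem_right (C (x j)) _ hp)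
          (Ideal.mul_mem_left _ p (Ideal.subset_span ⟨j, rfl⟩)) using 1
        rw [map_mul, eval_X, map_mul]
        ring
    intro p hp
    have h := key p
    rwa [(RingHom.mem_ker).1 hp, map_zero, sub_zero] at h
  · rw [Ideal.span_le]
    rintro _ ⟨j, rfl⟩
    simp [pointIdeal, RingHom.mem_ker]

theorem isCoprime_pointIdeal {x y : Fin n → finiteElements R} (h : stPoint x ≠ stPoint y) :
    IsCoprime (pointIdeal x) (pointIdeal y) := by
  obtain ⟨j, hj⟩ := Function.ne_iff.1 h
  have hu : IsUnit (x j - y j) := isUnit_of_stHom_ne_zero (by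
    rw [map_sub]
    exact sub_ne_zero.2 hj)
  rw [Ideal.isCoprime_iff_sup_eq]
  refine Ideal.eq_top_of_isUnit_mem _ ?_ (hu.map (C : _ →+* FinPoly R n))
  have e : (C (x j - y j) : FinPoly R n) = -(X j - C (x j)) + (X j - C (y j)) := by
    rw [map_sub]
    ring
  rw [e]
  refine Submodule.add_mem_sup (neg_mem ?_) ?_ <;> simp [pointIdeal, RingHom.mem_ker]

theorem prodIdeal_eq_iInf {k : ℕ} {x : Fin k → Fin n → finiteElements R}
    (hx : ∀ i j, i ≠ j → stPoint (x i) ≠ stPoint (x j)) :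
    prodIdeal x = ⨅ i, pointIdeal (x i) ^ 2 := by
  rw [prodIdeal, Ideal.prod_eq_iInf_of_pairwise_isCoprime]
  · simp
  · exact fun i _ j _ hij => (isCoprime_pointIdeal (hx i j hij)).pow

/-- `I` is contained in the square of the ideal generated by the `nᵏ` products of one linear form
`X_j - x_{i,j}` for each point `x i`. -/
theorem prodIdeal_le_span_sq {k : ℕ} (x : Fin k → Fin n → finiteElements R) :
    prodIdeal x ≤ Ideal.span (Set.range fun J : Fin k → Fin n =>
      ∏ i, (X (J i) - C (x i (J i)) : FinPoly R n)) ^ 2 := by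
  rw [prodIdeal, Finset.prod_pow]
  refine Ideal.pow_right_mono ?_ 2
  simp_rw [pointIdeal_eq_span]
  rw [Ideal.prod_span]
  refine Ideal.span_mono fun p hp => ?_
  obtain ⟨g, hg, rfl⟩ := (Set.mem_fintype_prod _ _).1 hp
  choose J hJ using hg
  exact ⟨J, by simp only [hJ]⟩

/-- `u` is the sum of the squares of the generators in `prodIdeal_le_span_sq`. -/
theorem prod_pointUnit_eq_sum_sq {k : ℕ} (x : Fin k → Fin n → finiteElements R) :
    ∏ i, pointUnit (x i) = ∑ J : Fin k → Fin n,
      (∏ i, (X (J i) - C (x i (J i)) : FinPoly R n)) ^ 2 := by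
  simp_rw [pointUnit]
  rw [Finset.prod_univ_sum, Fintype.piFinset_univ]
  simp_rw [Finset.prod_pow]

theorem isConeUnit_prodUnit {k : ℕ} {M : QuadModule (FinPoly R n)} (hM : M.IsArchimedean)
    (x : Fin k → Fin n → finiteElements R) :
    IsConeUnit (M.interIdeal (prodIdeal x)) (prodUnit x) := by
  intro p
  obtain ⟨N, hN, h⟩ := QuadModule.exists_nsmul_add_mem_of_mem_span_sq hM _
    (prodIdeal_le_span_sq x p.2)
  rw [← prod_pointUnit_eq_sum_sq] at h
  exact ⟨N, hN, h⟩

theorem prod_pointUnit_mul_mem {k : ℕ} (M : QuadModule (FinPoly R n))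
    (x : Fin k → Fin n → finiteElements R) (s : Finset (Fin k)) {m : FinPoly R n} (hm : m ∈ M) :
    (∏ i ∈ s, pointUnit (x i)) * m ∈ M := by
  classical
  induction s using Finset.induction_on with
  | empty => simpa using hm
  | insert i s hi ih =>
    rw [Finset.prod_insert hi, mul_assoc, pointUnit, Finset.sum_mul]
    exact M.sum_mem fun j _ => M.sq_mul_mem _ ih

/-! ### Second derivatives on `I_x²` -/

/-- The directional derivative `∑ₐ vₐ ∂ₐ` along `v`. -/
noncomputable def dirDeriv (v : Fin n → finiteElements R) :
    Derivation (finiteElements R) (FinPoly R n) (FinPoly R n) :=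
  ∑ a, v a • pderiv a

theorem dirDeriv_apply (v : Fin n → finiteElements R) (p : FinPoly R n) :
    dirDeriv v p = ∑ a, v a • pderiv a p := by
  rw [dirDeriv, ← Derivation.coeFnAddMonoidHom_apply, map_sum, Finset.sum_apply]
  rfl

theorem dirDeriv_X_sub_C (v : Fin n → finiteElements R) (j : Fin n) (c : finiteElements R) :
    dirDeriv v (X j - C c) = C (v j) := by
  classical
  simp [dirDeriv_apply, pderiv_X, Pi.single_apply, smul_eq_C_mul]

theorem hessForm_eq_eval_dirDeriv (p : FinPoly R n) (x : Fin n → finiteElements R)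
    (v : Fin n → ℝ) :
    hessForm p x v = eval x (dirDeriv (realPoint R v) (dirDeriv (realPoint R v) p)) := by
  simp only [hessForm, hessAt, dotProduct, Matrix.mulVec, Matrix.of_apply, dirDeriv_apply,
    map_sum, smul_eval, Derivation.map_smul, Finset.mul_sum]
  rw [Finset.sum_comm]
  exact Finset.sum_congr rfl fun a _ => Finset.sum_congr rfl fun b _ => by ring

/-- On `I_x²`, the Hessian at `x` only sees the values at `x` of the coefficients `a j l`. -/
theorem hessForm_eq_of_eq_sum {p : FinPoly R n} {x : Fin n → finiteElements R}
    {a : Fin n → Fin n → FinPoly R n}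
    (hp : p = ∑ j, ∑ l, a j l * ((X j - C (x j)) * (X l - C (x l)))) (v : Fin n → ℝ) :
    hessForm p x v =
      2 * ∑ j, ∑ l, eval x (a j l) * (realPoint R v j * realPoint R v l) := by
  rw [hessForm_eq_eval_dirDeriv, hp]
  simp only [map_sum, Finset.mul_sum]
  refine Finset.sum_congr rfl fun j _ => Finset.sum_congr rfl fun l _ => ?_
  simp only [Derivation.leibniz, dirDeriv_X_sub_C, smul_eq_mul, map_add, derivation_C]
  simp only [map_add, map_mul, map_sub, eval_X, eval_C, map_zero]
  ring

theorem exists_eq_sum_of_mem_pointIdeal_sq {x : Fin n → finiteElements R} {p : FinPoly R n}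
    (hp : p ∈ pointIdeal x ^ 2) : ∃ a : Fin n → Fin n → FinPoly R n,
      p = ∑ j, ∑ l, a j l * ((X j - C (x j)) * (X l - C (x l))) := by
  rw [pointIdeal_eq_span] at hp
  exact Ideal.exists_eq_sum_of_mem_span_range_sq hp

theorem hessForm_mul {x : Fin n → finiteElements R} {p : FinPoly R n}
    (hp : p ∈ pointIdeal x ^ 2) (b : FinPoly R n) (v : Fin n → ℝ) :
    hessForm (b * p) x v = eval x b * hessForm p x v := by
  obtain ⟨a, ha⟩ := exists_eq_sum_of_mem_pointIdeal_sq hp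
  have hb : b * p = ∑ j, ∑ l, (b * a j l) * ((X j - C (x j)) * (X l - C (x l))) := by
    simp only [ha, Finset.mul_sum, mul_assoc]
  rw [hessForm_eq_of_eq_sum ha, hessForm_eq_of_eq_sum hb]
  simp only [map_mul, Finset.mul_sum]
  exact Finset.sum_congr rfl fun j _ => Finset.sum_congr rfl fun l _ => by ring

/-- A positive semidefinite real `n × n` matrix is `Vᵀ V` for an `n × n` matrix `V`. -/
theorem exists_eq_sum_mul_of_nonneg {B : Matrix (Fin n) (Fin n) ℝ} (hsymm : ∀ j l, B j l = B l j)
    (hB : ∀ c : Fin n → ℝ, 0 ≤ ∑ j, ∑ l, c j * c l * B j l) :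
    ∃ v : Fin n → Fin n → ℝ, ∀ j l, B j l = ∑ m, v m j * v m l := by
  have hpsd : B.PosSemidef := .of_dotProduct_mulVec_nonneg
    (Matrix.IsHermitian.ext fun j l => by simpa using hsymm l j) fun c => by
      have e : star c ⬝ᵥ Matrix.mulVec B c = ∑ j, ∑ l, c j * c l * B j l := by
        simp only [dotProduct, Matrix.mulVec, Finset.mul_sum, Pi.star_apply, star_trivial]
        exact Finset.sum_congr rfl fun a _ => Finset.sum_congr rfl fun b _ => by ring
      rw [e]
      exact hB c
  open scoped MatrixOrder in
  obtain ⟨V, hV⟩ := CStarAlgebra.nonneg_iff_eq_star_mul_self.mp hpsd.nonneg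
  refine ⟨V, fun j l => ?_⟩
  rw [hV, Matrix.mul_apply]
  rfl

end FiniteElements

/-! ### Pure states of `(I, M ∩ I, u)` -/

section PureStates

variable {R : Type*} [Field R] [LinearOrder R] [IsStrictOrderedRing R] [Algebra ℝ R]
  {n k : ℕ} {x : Fin k → Fin n → finiteElements R}

theorem prodIdeal_le_pointIdeal_sq (x : Fin k → Fin n → finiteElements R) (i : Fin k) :
    prodIdeal x ≤ pointIdeal (x i) ^ 2 :=
  Ideal.le_of_dvd (Finset.dvd_prod_of_mem _ (Finset.mem_univ i))

theorem prod_erase_mul_mem_prodIdeal (i : Fin k) {p : FinPoly R n}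
    (hp : p ∈ pointIdeal (x i) ^ 2) :
    (∏ j ∈ Finset.univ.erase i, pointUnit (x j)) * p ∈ prodIdeal x := by
  rw [prodIdeal, ← Finset.prod_erase_mul _ _ (Finset.mem_univ i)]
  exact Ideal.mul_mem_mul (Ideal.prod_mem_prod fun j _ => pointUnit_mem (x j)) hp

theorem stEval_prod_pointUnit_ne_zero {y : Fin n → finiteElements R} {s : Finset (Fin k)}
    (h : ∀ j ∈ s, stPoint y ≠ stPoint (x j)) :
    stEval y (∏ j ∈ s, pointUnit (x j)) ≠ 0 := by
  rw [map_prod]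
  exact Finset.prod_ne_zero_iff.2 fun j hj => stEval_pointUnit_ne_zero (h j hj)

theorem stdPart_eval_div_eval (y : Fin n → finiteElements R) (p : FinPoly R n) {q : FinPoly R n}
    (hq : stEval y q ≠ 0) :
    ArchimedeanClass.stdPart ((eval y p : R) / (eval y q : R)) = stEval y p / stEval y q :=
  stdPart_coe_div_coe _ hq

theorem stdPart_hessForm_div {m : ℕ} (i : Fin k)
    (hx : ∀ i j, i ≠ j → stPoint (x i) ≠ stPoint (x j)) (p : FinPoly R n)
    (v : Fin m → Fin n → ℝ) :
    ArchimedeanClass.stdPart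
      (((∑ l, hessForm p (x i) (v l) : finiteElements R) : R) /
        (2 * ∏ j ∈ Finset.univ.erase i, (eval (x i) (pointUnit (x j)) : R))) =
      stHom R (∑ l, hessForm p (x i) (v l)) /
        (2 * stEval (x i) (∏ j ∈ Finset.univ.erase i, pointUnit (x j))) := by
  have hW : stEval (x i) (∏ j ∈ Finset.univ.erase i, pointUnit (x j)) ≠ 0 :=
    stEval_prod_pointUnit_ne_zero fun j hj => hx i j (Finset.ne_of_mem_erase hj).symm
  have e : (2 * ∏ j ∈ Finset.univ.erase i, (eval (x i) (pointUnit (x j)) : R)) =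
      ((2 * eval (x i) (∏ j ∈ Finset.univ.erase i, pointUnit (x j)) : finiteElements R) : R) := by
    rw [map_prod]
    push_cast
    rfl
  have e2 : stHom R (2 * eval (x i) (∏ j ∈ Finset.univ.erase i, pointUnit (x j))) =
      2 * stEval (x i) (∏ j ∈ Finset.univ.erase i, pointUnit (x j)) := by
    rw [map_mul, map_ofNat, stEval_apply]
  rw [e, stdPart_coe_div_coe _ (by rw [e2]; exact mul_ne_zero two_ne_zero hW), e2]

/-- A state on which the polynomials act through evaluation at the standard part of `x i` is a
second-order differential operator at `x i`. With `w = ∏_{j ≠ i} u_{x_j}` and `T_j = X_j - x_{i,j}`,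
the matrix `φ (w T_j T_l)` is positive semidefinite of trace `φ u = 1`, hence of the form `Vᵀ V`;
the rows of `V` are the vectors `v_l`. Every `p ∈ I` is a combination of the `T_j T_l`, which
determines `φ (w p)`, and `φ (w p)` is the nonzero multiple `st (w (x i)) φ p` of `φ p`. -/
theorem exists_apply_eq_hessForm_div {M : QuadModule (FinPoly R n)} {φ : prodIdeal x →ₗ[ℝ] ℝ}
    (hx : ∀ i j, i ≠ j → stPoint (x i) ≠ stPoint (x j))
    (hφ : φ ∈ stateSpace (M.interIdeal (prodIdeal x) : Set (prodIdeal x)) (prodUnit x))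
    (i : Fin k) (hmul : ∀ (a : FinPoly R n) (p : prodIdeal x), φ (a • p) = stEval (x i) a * φ p) :
    ∃ v : Fin n → Fin n → ℝ, ∑ l, v l ⬝ᵥ v l = 1 ∧ ∀ p : prodIdeal x,
      φ p = ArchimedeanClass.stdPart
        (((∑ l, hessForm (p : FinPoly R n) (x i) (v l) : finiteElements R) : R) /
          (2 * ∏ j ∈ Finset.univ.erase i, (eval (x i) (pointUnit (x j)) : R))) := by
  set w : FinPoly R n := ∏ j ∈ Finset.univ.erase i, pointUnit (x j) with hw
  have hW : stEval (x i) w ≠ 0 :=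
    stEval_prod_pointUnit_ne_zero fun j hj => hx i j (Finset.ne_of_mem_erase hj).symm
  let T : Fin n → FinPoly R n := fun j => X j - C (x i j)
  have hT : ∀ j, T j ∈ pointIdeal (x i) := fun j => by simp [T, pointIdeal, RingHom.mem_ker]
  let E : Fin n → Fin n → prodIdeal x := fun j l => ⟨w * (T j * T l),
    prod_erase_mul_mem_prodIdeal i (by rw [pow_two]; exact Ideal.mul_mem_mul (hT j) (hT l))⟩
  have hE : ∀ j l, (E j l : FinPoly R n) = w * (T j * T l) := fun _ _ => rfl
  obtain ⟨v, hv⟩ := exists_eq_sum_mul_of_nonneg (B := fun j l => φ (E j l))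
    (fun j l => congrArg φ (Subtype.ext (by rw [hE, hE, mul_comm (T j)]))) (by
      intro c
      have h : 0 ≤ φ (∑ j, ∑ l, (c j * c l) • E j l) := by
        refine hφ.1 _ ?_
        have e : ((∑ j, ∑ l, (c j * c l) • E j l : prodIdeal x) : FinPoly R n) =
            w * (∑ j, c j • T j) ^ 2 := by
          rw [pow_two, Finset.sum_mul_sum]
          simp only [AddSubmonoidClass.coe_finsetSum, Submodule.coe_smul_of_tower, hE,
            Finset.mul_sum, Algebra.smul_def, map_mul]
          exact Finset.sum_congr rfl fun a _ => Finset.sum_congr rfl fun b _ => by ring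
        change ((∑ j, ∑ l, (c j * c l) • E j l : prodIdeal x) : FinPoly R n) ∈ M
        rw [e]
        exact prod_pointUnit_mul_mem M x _ (M.sq_mem _)
      simpa only [map_sum, φ.map_smul, smul_eq_mul] using h)
  refine ⟨v, ?_, fun p => ?_⟩
  · have e : ∑ j, E j j = prodUnit x := by
      apply Subtype.ext
      rw [AddSubmonoidClass.coe_finsetSum]
      simp only [hE, ← Finset.mul_sum, ← pow_two]
      exact Finset.prod_erase_mul _ _ (Finset.mem_univ i)
    have h := hφ.2
    rw [← e, map_sum] at h
    simp only [hv] at h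
    rw [Finset.sum_comm] at h
    exact h
  · obtain ⟨a, ha⟩ := exists_eq_sum_of_mem_pointIdeal_sq (prodIdeal_le_pointIdeal_sq x i p.2)
    rw [stdPart_hessForm_div i hx, eq_div_iff (mul_ne_zero two_ne_zero hW)]
    have h1 : w • p = ∑ j, ∑ l, a j l • E j l := by
      apply Subtype.ext
      simp only [AddSubmonoidClass.coe_finsetSum, Submodule.coe_smul, hE, smul_eq_mul]
      rw [ha, Finset.mul_sum]
      simp only [Finset.mul_sum]
      exact Finset.sum_congr rfl fun a _ => Finset.sum_congr rfl fun b _ => by ring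
    have h2 := congrArg φ h1
    rw [hmul] at h2
    simp only [map_sum, hmul, hv] at h2
    have h3 : ∀ m, stHom R (hessForm (p : FinPoly R n) (x i) (v m)) =
        2 * ∑ j, ∑ l, stEval (x i) (a j l) * (v m j * v m l) := by
      intro m
      rw [hessForm_eq_of_eq_sum ha]
      have hr : ∀ j, stHom R (realPoint R (v m) j) = v m j := fun j => (stHom R).commutes _
      simp only [map_mul, map_sum, map_ofNat, hr, stEval_apply]
    have h4 : ∑ j, ∑ l, stEval (x i) (a j l) * ∑ m, v m j * v m l =
        ∑ m, ∑ j, ∑ l, stEval (x i) (a j l) * (v m j * v m l) := by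
      simp only [Finset.mul_sum]
      exact (Finset.sum_congr rfl fun j _ => Finset.sum_comm).trans Finset.sum_comm
    rw [map_sum]
    simp only [h3]
    rw [← Finset.mul_sum, ← h4, ← h2]
    ring

end PureStates

theorem mainTheorem9 {R : Type*} [Field R] [LinearOrder R] [IsStrictOrderedRing R]
    [IsRealClosed R] [Algebra ℝ R] {n k : ℕ}
    (M : QuadModule (FinPoly R n)) (hM : M.IsArchimedean)
    (x : Fin k → Fin n → finiteElements R)
    (hx : ∀ i j, i ≠ j → stPoint (x i) ≠ stPoint (x j)) :
    prodIdeal x = ⨅ i, pointIdeal (x i) ^ 2 ∧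
    IsConeUnit (M.interIdeal (prodIdeal x)) (prodUnit x) ∧
    ∀ φ : prodIdeal x →ₗ[ℝ] ℝ,
      IsPureState (M.interIdeal (prodIdeal x) : Set (prodIdeal x)) (prodUnit x) φ →
      Xor
        (∃ y ∈ stNonnegSet M \ Set.range (fun i => stPoint (x i)),
          ∀ p : prodIdeal x,
            φ p = ArchimedeanClass.stdPart
              ((eval (realPoint R y) (p : FinPoly R n) : R) /
                (eval (realPoint R y) (prodUnit x : FinPoly R n) : R)))
        (∃ (i : Fin k) (v : Fin n → Fin n → ℝ),
          ∑ l, v l ⬝ᵥ v l = 1 ∧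
          ∀ p : prodIdeal x,
            φ p = ArchimedeanClass.stdPart
              (((∑ l, hessForm (p : FinPoly R n) (x i) (v l) : finiteElements R) : R) /
                (2 * ∏ j ∈ Finset.univ.erase i, (eval (x i) (pointUnit (x j)) : R)))) := by
  have hunit := isConeUnit_prodUnit hM x
  refine ⟨prodIdeal_eq_iInf hx, hunit, fun φ hφ => ?_⟩
  have huM : ∀ m ∈ M, m * (prodUnit x : FinPoly R n) ∈ M := fun m hm => by
    rw [mul_comm]
    exact prod_pointUnit_mul_mem M x _ hm
  have hu1 : φ (prodUnit x) = 1 := hφ.1.2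
  -- `φ` is multiplicative over evaluation at the real point `y` obtained from `a ↦ φ (a u)`
  have hmul := QuadModule.apply_smul_of_isPureState hM hunit huM hφ
  let Φ := QuadModule.stateHom φ (prodUnit x) hu1 hmul
  let y : Fin n → ℝ := fun j => Φ (X j)
  have hΦ : ∀ a, φ (a • prodUnit x) = stEval (realPoint R y) a := algHom_finPoly_eq_stEval Φ
  simp only [hΦ] at hmul
  rw [xor_iff_or_and_not_and]
  constructor
  · by_cases hy : y ∈ Set.range fun i => stPoint (x i)
    · obtain ⟨i, hi⟩ := hy
      have hst : stEval (realPoint R y) = stEval (x i) :=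
        stEval_eq_of_stPoint_eq (by rw [stPoint_realPoint, ← hi])
      rw [hst] at hmul
      exact Or.inr ⟨i, exists_apply_eq_hessForm_div hx hφ.1 i hmul⟩
    · refine Or.inl ⟨y, ⟨fun p hp => ?_, hy⟩, fun p => ?_⟩
      · have h := hφ.1.1 (p • prodUnit x) (huM p hp)
        rwa [hΦ] at h
      · have hne : stEval (realPoint R y) (prodUnit x : FinPoly R n) ≠ 0 :=
          stEval_prod_pointUnit_ne_zero fun j _ h => hy ⟨j, h.symm.trans (stPoint_realPoint y)⟩
        rw [stdPart_eval_div_eval _ _ hne, eq_div_iff hne, mul_comm, ← hmul, ← mul_one (stEval _ _),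
          ← hu1, ← hmul]
        exact congrArg φ (Subtype.ext (mul_comm _ _))
  · -- in the first case `φ (X_j u)` is the `j`-th coordinate of `z`, in the second that of `st (x i)`
    rintro ⟨⟨z, ⟨-, hz⟩, h1⟩, i, v, -, h2⟩
    refine hz ⟨i, funext fun j => ?_⟩
    have hne : stEval (realPoint R z) (prodUnit x : FinPoly R n) ≠ 0 :=
      stEval_prod_pointUnit_ne_zero fun j _ h => hz ⟨j, h.symm.trans (stPoint_realPoint z)⟩
    have e1 : φ ((X j : FinPoly R n) • prodUnit x) = z j := by
      rw [h1, stdPart_eval_div_eval _ _ hne, Submodule.coe_smul, smul_eq_mul, map_mul,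
        mul_div_cancel_right₀ _ hne, stEval_X, stPoint_realPoint]
    have e2 : φ ((X j : FinPoly R n) • prodUnit x) = stPoint (x i) j := by
      have h := h2 (prodUnit x)
      rw [hu1, stdPart_hessForm_div i hx] at h
      rw [h2, stdPart_hessForm_div i hx, Submodule.coe_smul, smul_eq_mul]
      simp only [hessForm_mul (prodIdeal_le_pointIdeal_sq x i (prodUnit x).2)]
      rw [← Finset.mul_sum, map_mul, mul_div_assoc, ← h, mul_one, ← stEval_apply, stEval_X]
    exact e2.symm.trans e1
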